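/- Let $I$ be a finite set with a fixed total order, let $C=(d_{ij})_{i,j\in I}$ be a symmetric Cartan matrix, i.e. $d_{ii}=2$ and $d_{ij}=d_{ji}\in\{0,-1,-2,\dots\}$ for $i\neq j$, let $\mathbb K$ be a field of characteristic $0$, and let $q\in\mathbb K^\times$ not be a root of unity. Let $\widetilde U_q^+(L\mathfrak g)$ be the unital associative $\mathbb K$-algebra generated by $e_{i,k}$ ($i\in I$, $k\in\mathbb Z$) modulo the coefficients, for all $i,j\in I$, of the relations $$e_i(z)e_j(w)\,(z-wq^{d_{ij}})=e_j(w)e_i(z)\,(zq^{d_{ij}}-w),\qquad e_i(z)=\sum_{k\in\mathbb Z}e_{i,k}z^{-k}.$$ A word is a finite sequence $w=[i_1^{(k_1)}\dots i_n^{(k_n)}]$ with $n\ge 0$, $i_a\in I$, $k_a\in\mathbb Z$; put $e_w=e_{i_1,k_1}\cdots e_{i_n,k_n}$. Order letters by $i^{(k)}<j^{(l)}$ iff $k>l$, or $k=l$ and $i<j$, and order words lexicographically (a proper prefix being smaller). The word $w$ is called non-increasing if for all $1\le a<b\le n$, with $c_{ab}=\#\{s\in\{a,\dots,b-1\}: i_s\neq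 i_b\}$, either $k_a<k_b+c_{ab}$, or $k_a=k_b+c_{ab}$ and $i_a\ge i_b$. Proposition 4.2. The elements $e_w$, as $w$ runs over all non-increasing words, form a linear basis of $\widetilde U_q^+(L\mathfrak g)$. Moreover, there are constants $\beta(n)\ge 0$, depending only on $n$, such that for every word $[i_1^{(k_1)}\dots i_n^{(k_n)}]$ the product $e_{i_1,k_1}\cdots e_{i_n,k_n}$ lies in the linear span of the elements $e_{j_1,l_1}\cdots e_{j_n,l_n}$ for which $[j_1^{(l_1)}\dots j_n^{(l_n)}]$ is non-increasing and $\ge[i_1^{(k_1)}\dots i_n^{(k_n)}]$, and $$\min_a k_a-\beta(n)\le \min_a l_a\le \max_a l_a\le \max_a k_a+\beta(n)$$ (the last condition being empty for $n=0$). -/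

import Mathlib

namespace QuantumLoop

/-- A symmetric (generalized) Cartan matrix with rows and columns indexed by `I`. -/
structure IsSymmetricCartan {I : Type*} (d : Matrix I I ℤ) : Prop where
  diag : ∀ i, d i i = 2
  symm : ∀ i j, d i j = d j i
  nonpos : ∀ i j, i ≠ j → d i j ≤ 0

/-- The free generator `e_{i,k}` of the free algebra on the symbols `e_{i,k}`. -/
def freeGen (K : Type*) [Field K] {I : Type*} (i : I) (k : ℤ) : FreeAlgebra K (I × ℤ) :=
  FreeAlgebra.ι K (i, k)

/-- The quadratic relation
`e_i(z) e_j(w) (z - w q^{d_ij}) = e_j(w) e_i(z) (z q^{d_ij} - w)`, where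
`e_i(z) = ∑_k e_{i,k} z^{-k}`: the constructor `coeff i j k l` equates the coefficients of
`z^{-k} w^{-l}` on the two sides. -/
inductive QuadRel {K : Type*} [Field K] {I : Type*} (d : Matrix I I ℤ) (q : K) :
    FreeAlgebra K (I × ℤ) → FreeAlgebra K (I × ℤ) → Prop
  | coeff (i j : I) (k l : ℤ) :
      QuadRel d q
        (freeGen K i (k + 1) * freeGen K j l
          - (q ^ d i j) • (freeGen K i k * freeGen K j (l + 1)))
        ((q ^ d i j) • (freeGen K j l * freeGen K i (k + 1))
          - freeGen K j (l + 1) * freeGen K i k)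

/-- The quadratic algebra `Ũ_q^+(Lg)`: the free unital associative algebra on the `e_{i,k}`,
modulo the two-sided ideal generated by the quadratic relations. -/
abbrev QuadAlgebra {K : Type*} [Field K] {I : Type*} (d : Matrix I I ℤ) (q : K) :=
  RingQuot (QuadRel d q)

/-- The generator `e_{i,k}` of the quadratic algebra. -/
def gen {K : Type*} [Field K] {I : Type*} (d : Matrix I I ℤ) (q : K) (i : I) (k : ℤ) :
    QuadAlgebra d q :=
  RingQuot.mkAlgHom K (QuadRel d q) (freeGen K i k)

/-- Words in the letters `i^{(k)}`; the letter `i^{(k)}` is the pair `(i, k)`. -/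
abbrev Word (I : Type*) := List (I × ℤ)

/-- The monomial `e_w = e_{i_1,k_1} ⋯ e_{i_n,k_n}` of a word `w`. -/
def monomial {K : Type*} [Field K] {I : Type*} (d : Matrix I I ℤ) (q : K) (w : Word I) :
    QuadAlgebra d q :=
  (w.map fun x => gen d q x.1 x.2).prod

/-- The strict order on letters: `i^{(k)} < j^{(l)}` iff `k > l`, or `k = l` and `i < j`. -/
def LetterLT {I : Type*} [LinearOrder I] (x y : I × ℤ) : Prop :=
  x.2 > y.2 ∨ (x.2 = y.2 ∧ x.1 < y.1)

/-- The (weak) lexicographic order `w ≤ v` on words; a proper prefix is smaller. -/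
def WordLE {I : Type*} [LinearOrder I] (w v : Word I) : Prop :=
  w = v ∨ List.Lex LetterLT w v

/-- The number of positions `s ∈ {a, …, b - 1}` with `i_s ≠ i_b`. -/
def diffCount {I : Type*} [LinearOrder I] (w : Word I) (a b : Fin w.length) : ℕ :=
  ((Finset.Ico a b).filter fun s => (w.get s).1 ≠ (w.get b).1).card

/-- Non-increasing words. -/
def NonIncreasing {I : Type*} [LinearOrder I] (w : Word I) : Prop :=
  ∀ a b : Fin w.length, a < b →
    ((w.get a).2 < (w.get b).2 + (diffCount w a b : ℤ) ∨
      ((w.get a).2 = (w.get b).2 + (diffCount w a b : ℤ) ∧ (w.get a).1 ≥ (w.get b).1))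

/-- Every exponent of `v` is at least (the minimal exponent of `w`) `- β` and at most
(the maximal exponent of `w`) `+ β`. Vacuous when `v` is empty. -/
def ExponentsWithin {I : Type*} (β : ℕ) (w v : Word I) : Prop :=
  ∀ y ∈ v, (∃ x ∈ w, x.2 - (β : ℤ) ≤ y.2) ∧ (∃ x ∈ w, y.2 ≤ x.2 + (β : ℤ))

end QuantumLoop

/-! Spanning is a straightening argument. Being non-increasing is a condition on adjacent letters
only, and the quadratic relation rewrites each offending adjacent pair through lexicographically
larger pairs whose exponents stay between the two original ones (`straighten`). Only finitely many
words have a given length and exponents in a given range, so the rewriting stops; as the range never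
grows, `β = 0` works.

Independence comes from a right action on polynomials in variables y_{i,p}: e_i(z) acts as Γ_i(z)
∑_p z^{-p} ∂/∂y_{i,p}. Reading y_{j,p} as w^{-p}, the algebra homomorphism Γ_i(z) multiplies it by
±1/(z - q^{d_ij} w) if i ≠ j, and by (z - w)/(z - q^{d_ii} w) if i = j, expanded in powers of w/z.
Moving a derivative past Γ_i(z) produces this factor and everything else commutes, so the quadratic
relation reduces to an identity between the factors for (i, j) and (j, i) (`pairCoeff_relation`,
`peel_relation`).

For i ≠ j the expansion starts at z^{-1}; these shifts add up to the counts c_{ab}. A non-increasing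
word w thus has a test monomial `leadingList w` that e_w does not kill, while e_v kills it unless v
≤ w (`peelRep_leadingList_ne_zero`, `wordLE_of_peelRep_leadingList_ne_zero`). This triangularity
gives independence. -/

namespace QuantumLoop

/-! ### Non-increasing words as chains, and the order on words -/

section Chain

variable {I : Type*} [LinearOrder I]

/-- The condition `NonIncreasing` imposes on two adjacent letters. -/
def StepLE (x y : I × ℤ) : Prop :=
  x.2 ≤ y.2 + if y.1 < x.1 then 1 else 0

/-- The inductive step from adjacent letters to distant ones: prepending `x` raises the count unless
`x` has color `j`. A step upward by one is allowed only if the color of `y` is below that of `x`;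
when `x` has color at most `j`, this forces the strict alternative for `y`. -/
theorem StepLE.trans_count {x y : I × ℤ} {j : I} {p c : ℤ} (hxy : StepLE x y)
    (hy : y.2 < p + c ∨ (y.2 = p + c ∧ y.1 ≥ j)) :
    x.2 < p + (c + if x.1 ≠ j then 1 else 0) ∨
      (x.2 = p + (c + if x.1 ≠ j then 1 else 0) ∧ x.1 ≥ j) := by
  unfold StepLE at hxy
  rcases lt_trichotomy x.1 j with h | h | h <;> grind

theorem stepLE_iff {x y : I × ℤ} :
    StepLE x y ↔ x.2 < y.2 + (if x.1 ≠ y.1 then 1 else 0) ∨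
      (x.2 = y.2 + (if x.1 ≠ y.1 then 1 else 0) ∧ x.1 ≥ y.1) := by
  unfold StepLE
  rcases lt_trichotomy x.1 y.1 with h | h | h <;> grind

theorem diffCount_succ (w : Word I) (a b c : Fin w.length) (hc : c.val = a.val + 1) (hab : a < b) :
    diffCount w a b = diffCount w c b + if (w.get a).1 ≠ (w.get b).1 then 1 else 0 := by
  have h : Finset.Ico a b = insert a (Finset.Ico c b) := by
    ext x
    simp only [Finset.mem_Ico, Finset.mem_insert, Fin.le_def, Fin.lt_def, Fin.ext_iff] at *
    omega
  have ha : a ∉ Finset.Ico c b := by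
    simp [Fin.le_def, hc]
  unfold diffCount
  rw [h, Finset.filter_insert]
  split_ifs with h1
  · rw [Finset.card_insert_of_notMem (by simp [ha])]
  · rfl

theorem diffCount_self (w : Word I) (a : Fin w.length) : diffCount w a a = 0 := by
  simp [diffCount]

/-- A word is non-increasing as soon as its adjacent letters satisfy `StepLE`. -/
theorem nonIncreasing_iff_isChain (w : Word I) : NonIncreasing w ↔ w.IsChain StepLE := by
  rw [List.isChain_iff_getElem]
  constructor
  · intro h n hn
    have h1 := h ⟨n, by omega⟩ ⟨n + 1, hn⟩ (Nat.lt_succ_self n)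
    rw [diffCount_succ w _ _ ⟨n + 1, hn⟩ rfl (Nat.lt_succ_self n), diffCount_self] at h1
    rw [stepLE_iff]
    simpa using h1
  · intro h
    have key : ∀ m : ℕ, ∀ a b : Fin w.length, b.val = a.val + m →
        ((w.get a).2 < (w.get b).2 + (diffCount w a b : ℤ) ∨
          ((w.get a).2 = (w.get b).2 + (diffCount w a b : ℤ) ∧ (w.get a).1 ≥ (w.get b).1)) := by
      intro m
      induction m with
      | zero =>
        intro a b hab
        obtain rfl : b = a := Fin.ext (by simpa using hab)
        simp [diffCount_self]
      | succ m ih =>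
        intro a b hab
        have hb := b.isLt
        have hc : a.val + 1 < w.length := by omega
        have h1 := ih ⟨a.val + 1, hc⟩ b (by simp; omega)
        have h2 := (h a.val hc).trans_count h1
        rw [diffCount_succ w a b ⟨a.val + 1, hc⟩ rfl (Fin.lt_def.2 (by omega))]
        simpa using h2
    intro a b hab
    exact key (b.val - a.val) a b (by rw [Fin.lt_def] at hab; omega)

instance : IsStrictTotalOrder (I × ℤ) LetterLT where
  trichotomous x y := by
    unfold LetterLT
    intro h1 h2
    push Not at h1 h2
    have : x.2 = y.2 := le_antisymm h1.1 h2.1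
    exact Prod.ext (le_antisymm (h2.2 this.symm) (h1.2 this)) this
  irrefl x := by simp [LetterLT]
  trans x y z := by
    unfold LetterLT
    rintro (h1 | h1) (h2 | h2)
    · left; omega
    · left; omega
    · left; omega
    · right; exact ⟨h1.1.trans h2.1, h1.2.trans h2.2⟩

instance : IsStrictOrder (Word I) (List.Lex LetterLT) where
  irrefl := List.lex_irrefl (irrefl_of LetterLT)
  trans _ _ _ h h' := List.lex_trans (fun h h' => trans_of LetterLT h h') h h'

theorem WordLE.trans {u v w : Word I} (h : WordLE u v) (h' : WordLE v w) : WordLE u w := by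
  rcases h with rfl | h
  · exact h'
  · rcases h' with rfl | h'
    · exact Or.inr h
    · exact Or.inr (trans_of (List.Lex LetterLT) h h')

end Chain

/-! ### Words with exponents in a fixed range -/

section ExponentsWithin

variable {I : Type*}

theorem ExponentsWithin.trans {u v w : Word I} (h : ExponentsWithin 0 u v)
    (h' : ExponentsWithin 0 v w) : ExponentsWithin 0 u w := by
  intro y hy
  obtain ⟨⟨a, ha, ha'⟩, ⟨b, hb, hb'⟩⟩ := h' y hy
  obtain ⟨c, hc, hc'⟩ := (h a ha).1
  obtain ⟨e, he, he'⟩ := (h b hb).2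
  exact ⟨⟨c, hc, by simp at *; omega⟩, ⟨e, he, by simp at *; omega⟩⟩

theorem ExponentsWithin.refl (w : Word I) : ExponentsWithin 0 w w :=
  fun y hy => ⟨⟨y, hy, by simp⟩, ⟨y, hy, by simp⟩⟩

theorem finite_exponentsWithin [Finite I] (w : Word I) :
    {v : Word I | v.length = w.length ∧ ExponentsWithin 0 w v}.Finite := by
  obtain ⟨lo, hlo⟩ : ∃ lo, ∀ x ∈ w, lo ≤ x.2 := by
    obtain ⟨lo, h⟩ := (w.map Prod.snd).toFinset.bddBelow
    exact ⟨lo, fun x hx => h (by simpa using ⟨x.1, hx⟩)⟩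
  obtain ⟨hi, hhi⟩ : ∃ hi, ∀ x ∈ w, x.2 ≤ hi := by
    obtain ⟨hi, h⟩ := (w.map Prod.snd).toFinset.bddAbove
    exact ⟨hi, fun x hx => h (by simpa using ⟨x.1, hx⟩)⟩
  have := (List.finite_length_eq (I × Set.Icc lo hi) w.length).image
    (List.map fun x : I × Set.Icc lo hi => (x.1, (x.2 : ℤ)))
  refine this.subset ?_
  rintro v ⟨hv, hw⟩
  have hr : ∀ y ∈ v, ∃ z : I × Set.Icc lo hi, (z.1, (z.2 : ℤ)) = y := by
    intro y hy
    obtain ⟨⟨a, ha, ha'⟩, ⟨b, hb, hb'⟩⟩ := hw y hy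
    have h1 := hlo a ha
    have h2 := hhi b hb
    exact ⟨(y.1, ⟨y.2, by simp at *; constructor <;> omega⟩), rfl⟩
  have hv' : v ∈ Set.range (List.map fun x : I × Set.Icc lo hi => (x.1, (x.2 : ℤ))) := by
    rw [Set.range_list_map]
    exact hr
  obtain ⟨z, rfl⟩ := hv'
  exact ⟨z, by simpa using hv, rfl⟩

end ExponentsWithin

/-! ### Straightening into non-increasing words -/

section Span

variable {K : Type*} [Field K] {I : Type*}

theorem monomial_append (d : Matrix I I ℤ) (q : K) (u v : Word I) :
    monomial d q (u ++ v) = monomial d q u * monomial d q v := by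
  simp [monomial]

theorem monomial_cons (d : Matrix I I ℤ) (q : K) (x : I × ℤ) (v : Word I) :
    monomial d q (x :: v) = gen d q x.1 x.2 * monomial d q v := by
  simp [monomial]

theorem gen_relation (d : Matrix I I ℤ) (q : K) (i j : I) (k l : ℤ) :
    gen d q i (k + 1) * gen d q j l - q ^ d i j • (gen d q i k * gen d q j (l + 1)) =
      q ^ d i j • (gen d q j l * gen d q i (k + 1)) - gen d q j (l + 1) * gen d q i k := by
  have := RingQuot.mkAlgHom_rel K (QuadRel.coeff (d := d) (q := q) i j k l)
  simpa [gen] using this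

variable [LinearOrder I]

/-- The two-letter words on the right-hand side of the straightening of `[x y]`. -/
def straightTargets (x y : I × ℤ) : Set (Word I) :=
  {v | ∃ a b : I × ℤ, v = [a, b] ∧ LetterLT x a ∧
    y.2 ≤ a.2 ∧ a.2 ≤ x.2 ∧ y.2 ≤ b.2 ∧ b.2 ≤ x.2}

/-- Solve the relation at (k - 1, l) for e_{i,k} e_{j,l}. The other three products have exponents in
[l, k], and their first letters are larger than i^{(k)}, except in one degenerate case. -/
theorem straighten [CharZero K] {d : Matrix I I ℤ} (q : K)
    {x y : I × ℤ} (h : ¬ StepLE x y) :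
    monomial d q [x, y] ∈ Submodule.span K (monomial d q '' straightTargets x y) := by
  obtain ⟨i, k⟩ := x
  obtain ⟨j, l⟩ := y
  have hm : ∀ a b : I × ℤ, monomial d q [a, b] = gen d q a.1 a.2 * gen d q b.1 b.2 := by
    intro a b; simp [monomial]
  have mem : ∀ a b : I × ℤ, LetterLT (i, k) a → l ≤ a.2 → a.2 ≤ k → l ≤ b.2 → b.2 ≤ k →
      gen d q a.1 a.2 * gen d q b.1 b.2 ∈
        Submodule.span K (monomial d q '' straightTargets (i, k) (j, l)) := by
    intro a b h1 h2 h3 h4 h5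
    exact Submodule.subset_span ⟨[a, b], ⟨a, b, rfl, h1, h2, h3, h4, h5⟩, hm a b⟩
  have hr := gen_relation d q i j (k - 1) l
  rw [sub_add_cancel, sub_eq_iff_eq_add] at hr
  unfold StepLE at h
  rw [hm]
  simp only at h ⊢
  -- Here the last product of the relation is the original one; moving it across gives twice the
  -- original, and 2 is invertible.
  by_cases hspecial : i = j ∧ k = l + 1
  · obtain ⟨rfl, rfl⟩ := hspecial
    rw [add_sub_cancel_right] at hr
    have h2 : gen d q i (l + 1) * gen d q i l =
        q ^ d i i • (gen d q i l * gen d q i (l + 1)) := by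
      have : (2 : K) • (gen d q i (l + 1) * gen d q i l) =
          (2 : K) • (q ^ d i i • (gen d q i l * gen d q i (l + 1))) := by
        rw [two_smul, two_smul]
        nth_rewrite 1 [hr]
        abel
      exact smul_right_injective _ (two_ne_zero : (2 : K) ≠ 0) this
    rw [h2]
    exact Submodule.smul_mem _ _ (mem (i, l) (i, l + 1) (by simp [LetterLT]) (by simp) (by simp)
      (by simp) (by simp))
  · have hkl : l + 1 ≤ k := by split_ifs at h <;> omega
    have hlt : LetterLT (i, k) (j, l + 1) := by
      unfold LetterLT
      simp only
      rcases lt_trichotomy i j with h1 | h1 | h1 <;> grind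
    rw [hr]
    refine add_mem (sub_mem (Submodule.smul_mem _ _ ?_) ?_) (Submodule.smul_mem _ _ ?_)
    · exact mem (j, l) (i, k) (by simp [LetterLT]; omega) (by simp) (by simp; omega)
        (by simp; omega) (by simp)
    · exact mem (j, l + 1) (i, k - 1) hlt (by simp) (by simpa using hkl)
        (by simp; omega) (by simp)
    · exact mem (i, k - 1) (j, l + 1) (by simp [LetterLT]) (by simp; omega) (by simp)
        (by simp) (by simpa using hkl)

theorem monomial_mem_span_larger [CharZero K] {d : Matrix I I ℤ} (q : K) {w : Word I}
    (hw : ¬ NonIncreasing w) :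
    monomial d q w ∈ Submodule.span K (monomial d q ''
      {v | v.length = w.length ∧ List.Lex LetterLT w v ∧ ExponentsWithin 0 w v}) := by
  rw [nonIncreasing_iff_isChain, List.isChain_iff_forall_rel_of_append_cons_cons] at hw
  push Not at hw
  obtain ⟨x, y, u, t, rfl, hxy⟩ := hw
  have hsplit : ∀ a b : I × ℤ, monomial d q (u ++ a :: b :: t) =
      (LinearMap.mulLeft K (monomial d q u) ∘ₗ LinearMap.mulRight K (monomial d q t))
        (monomial d q [a, b]) := by
    intro a b
    rw [show u ++ a :: b :: t = u ++ ([a, b] ++ t) by simp, monomial_append, monomial_append]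
    rfl
  rw [hsplit]
  have := Submodule.mem_map_of_mem (f := LinearMap.mulLeft K (monomial d q u) ∘ₗ
    LinearMap.mulRight K (monomial d q t)) (straighten q hxy)
  rw [Submodule.map_span] at this
  refine Submodule.span_mono ?_ this
  rintro _ ⟨_, ⟨_, ⟨a, b, rfl, h1, h2, h3, h4, h5⟩, rfl⟩, rfl⟩
  refine ⟨u ++ a :: b :: t, ⟨by simp, List.Lex.append_left _ (.rel h1) _, ?_⟩, hsplit a b⟩
  intro z hz
  simp only [List.mem_append, List.mem_cons] at hz
  rcases hz with hz | rfl | rfl | hz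
  · exact ⟨⟨z, by simp [hz], by simp⟩, ⟨z, by simp [hz], by simp⟩⟩
  · exact ⟨⟨y, by simp, by simpa using h2⟩, ⟨x, by simp, by simpa using h3⟩⟩
  · exact ⟨⟨y, by simp, by simpa using h4⟩, ⟨x, by simp, by simpa using h5⟩⟩
  · exact ⟨⟨z, by simp [hz], by simp⟩, ⟨z, by simp [hz], by simp⟩⟩

/-- Induction along the reversed lexicographic order, well-founded on the finite set of words with
the length and exponent range of `w`. -/
theorem monomial_mem_span_nonIncreasing [CharZero K] [Finite I] {d : Matrix I I ℤ} (q : K)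
    (w : Word I) :
    monomial d q w ∈ Submodule.span K (monomial d q ''
      {v | v.length = w.length ∧ NonIncreasing v ∧ WordLE w v ∧ ExponentsWithin 0 w v}) := by
  have wf : Set.WellFoundedOn {v : Word I | v.length = w.length ∧ ExponentsWithin 0 w v}
      (Function.swap (List.Lex LetterLT)) := by
    have : IsStrictOrder (Word I) (Function.swap (List.Lex LetterLT)) := inferInstance
    exact (finite_exponentsWithin w).wellFoundedOn
  suffices H : ∀ v ∈ {v : Word I | v.length = w.length ∧ ExponentsWithin 0 w v},
      monomial d q v ∈ Submodule.span K (monomial d q ''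
        {u | u.length = v.length ∧ NonIncreasing u ∧ WordLE v u ∧ ExponentsWithin 0 v u}) from
    H w ⟨rfl, .refl w⟩
  intro v hv
  refine wf.induction (P := fun v => monomial d q v ∈ Submodule.span K (monomial d q ''
    {u | u.length = v.length ∧ NonIncreasing u ∧ WordLE v u ∧ ExponentsWithin 0 v u})) hv ?_
  intro v hv ih

  by_cases hn : NonIncreasing v
  · exact Submodule.subset_span ⟨v, ⟨rfl, hn, Or.inl rfl, .refl v⟩, rfl⟩
  · refine Submodule.span_le.2 ?_ (monomial_mem_span_larger q hn)
    rintro _ ⟨u, ⟨h1, h2, h3⟩, rfl⟩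
    refine Submodule.span_mono (Set.image_mono ?_)
      (ih u ⟨h1.trans hv.1, hv.2.trans h3⟩ h2)
    rintro t ⟨g1, g2, g3, g4⟩
    exact ⟨g1.trans h1, g2, WordLE.trans (Or.inr h2) g3, h3.trans g4⟩

end Span

/-! ### Polynomials, interaction factors and the homomorphisms Γ_i(z) -/

section Representation

/-- The polynomial ring in variables `y_{i,p}`, standing for the Laurent monomials `z^{-p}` of
color `i`. -/
abbrev ColoredPoly (K I : Type*) [Field K] := MvPolynomial (I × ℤ) K

variable {K : Type*} [Field K] {I : Type*}

/-- The commutator of two derivations is a derivation, and this one vanishes on the variables. -/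
theorem pderiv_comm (x y : I × ℤ) (f : ColoredPoly K I) :
    MvPolynomial.pderiv x (MvPolynomial.pderiv y f) =
      MvPolynomial.pderiv y (MvPolynomial.pderiv x f) := by
  classical
  have h : ⁅(MvPolynomial.pderiv x : Derivation K (ColoredPoly K I) (ColoredPoly K I)),
      (MvPolynomial.pderiv y : Derivation K (ColoredPoly K I) (ColoredPoly K I))⁆ = 0 := by
    refine MvPolynomial.derivation_ext fun z => ?_
    rw [Derivation.commutator_apply]
    simp only [MvPolynomial.pderiv_X, Pi.single_apply]
    split_ifs <;> simp
  rw [← sub_eq_zero, ← Derivation.commutator_apply, h, Derivation.zero_apply]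

theorem finite_pderiv (j : I) (f : ColoredPoly K I) :
    {p : ℤ | MvPolynomial.pderiv (j, p) f ≠ 0}.Finite := by
  refine (f.vars.image Prod.snd).finite_toSet.subset ?_
  intro p hp
  by_contra h
  refine hp (MvPolynomial.pderiv_eq_zero_of_notMem_vars fun h' => h ?_)
  simpa using ⟨j, h'⟩

theorem finite_support_of_pderiv {M : Type*} [Zero M] (j : I) (f : ColoredPoly K I) {F : ℤ → M}
    (hF : ∀ p, MvPolynomial.pderiv (j, p) f = 0 → F p = 0) : F.HasFiniteSupport :=
  (finite_pderiv j f).subset fun p hp h => hp (hF p h)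

variable [LinearOrder I]

/-- A sign that is antisymmetric off the diagonal. -/
def orderSign (K : Type*) [Field K] (i j : I) : K := if i ≤ j then 1 else -1

theorem orderSign_ne_zero (i j : I) : orderSign K i j ≠ 0 := by
  unfold orderSign; split_ifs <;> simp

theorem orderSign_swap {i j : I} (h : i ≠ j) : orderSign K j i = -orderSign K i j := by
  unfold orderSign
  rcases lt_or_gt_of_ne h with h | h
  · simp [h.le, h.not_ge]
  · simp [h.le, h.not_ge]

/-- The coefficient of `x ^ r` in the expansion of `± 1 / (1 - q ^ d_ij x)` for `i ≠ j`, and of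
`(1 - x) / (1 - q ^ d_ii x)` for `i = j`. -/
def factorCoeff (d : Matrix I I ℤ) (q : K) (i j : I) (r : ℤ) : K :=
  if r < 0 then 0
  else orderSign K i j * (q ^ d i j) ^ r.toNat -
    if i = j ∧ 1 ≤ r then (q ^ d i j) ^ (r - 1).toNat else 0

theorem factorCoeff_of_neg (d : Matrix I I ℤ) (q : K) (i j : I) {r : ℤ} (hr : r < 0) :
    factorCoeff d q i j r = 0 := by simp [factorCoeff, hr]

theorem factorCoeff_zero (d : Matrix I I ℤ) (q : K) (i j : I) :
    factorCoeff d q i j 0 = orderSign K i j := by simp [factorCoeff]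

/-- Multiplying the expansion by 1 - q^{d_ij} x clears the denominator, leaving ±1 or 1 - x. -/
theorem factorCoeff_sub (d : Matrix I I ℤ) (q : K) (i j : I) (r : ℤ) :
    factorCoeff d q i j r - q ^ d i j * factorCoeff d q i j (r - 1) =
      (if r = 0 then orderSign K i j else 0) - if r = 1 ∧ i = j then 1 else 0 := by
  rcases lt_or_ge r 0 with h | h
  · rw [factorCoeff_of_neg _ _ _ _ h, factorCoeff_of_neg _ _ _ _ (by omega)]
    simp [h.ne, show r ≠ 1 by omega]
  · obtain ⟨n, rfl⟩ := Int.eq_ofNat_of_zero_le h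
    match n with
    | 0 => simp [factorCoeff]
    | 1 => by_cases hij : i = j <;> simp [factorCoeff, hij] <;> ring
    | n + 2 =>
      have h1 : ((n + 2 : ℕ) : ℤ) - 1 = (n + 1 : ℕ) := by push_cast; ring
      have h2 : ((n + 1 : ℕ) : ℤ) - 1 = n := by push_cast; ring
      simp only [factorCoeff, h1, h2, Int.toNat_natCast]
      by_cases hij : i = j
      · have h3 : ¬ ((n : ℤ) + 2 < 0) ∧ ¬ ((n : ℤ) + 1 < 0) ∧ (1 : ℤ) ≤ n + 2 ∧ (1 : ℤ) ≤ n + 1 ∧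
          (n : ℤ) + 2 ≠ 0 ∧ (n : ℤ) + 2 ≠ 1 := by omega
        simp [hij, h3]; ring
      · have h3 : ¬ ((n : ℤ) + 2 < 0) ∧ ¬ ((n : ℤ) + 1 < 0) ∧ (n : ℤ) + 2 ≠ 0 := by omega
        simp [hij, h3]; ring

/-- The power of `z⁻¹` split off from the interaction of the colors `i` and `j`. -/
def colorShift (i j : I) : ℕ := if i = j then 0 else 1

/-- The power series of `Γ_i(z) y_{j,p}` with the factor `z^{-s}`, `s = colorShift i j`,
removed. -/
noncomputable def gammaUnit (d : Matrix I I ℤ) (q : K) (i : I) :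
    ColoredPoly K I →ₐ[K] PowerSeries (ColoredPoly K I) :=
  MvPolynomial.aeval fun y => PowerSeries.mk fun m =>
    factorCoeff d q i y.1 m • MvPolynomial.X (y.1, y.2 - m)

/-- The algebra homomorphism multiplying each variable `y_{j,p}` by the interaction factor of
`i` and `j`, expanded in powers of `z⁻¹`. -/
noncomputable def gammaHom (d : Matrix I I ℤ) (q : K) (i : I) :
    ColoredPoly K I →ₐ[K] PowerSeries (ColoredPoly K I) :=
  MvPolynomial.aeval fun y => PowerSeries.X ^ colorShift i y.1 * gammaUnit d q i (MvPolynomial.X y)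

/-- The coefficient of `z^{-a}` in `Γ_i(z)`. -/
noncomputable def gammaCoeff (d : Matrix I I ℤ) (q : K) (i : I) (a : ℤ) :
    ColoredPoly K I →ₗ[K] ColoredPoly K I where
  toFun h := if 0 ≤ a then PowerSeries.coeff a.toNat (gammaHom d q i h) else 0
  map_add' x y := by split_ifs <;> simp
  map_smul' c x := by split_ifs <;> simp

theorem gammaCoeff_of_neg (d : Matrix I I ℤ) (q : K) (i : I) {a : ℤ} (ha : a < 0)
    (h : ColoredPoly K I) : gammaCoeff d q i a h = 0 := by
  simp [gammaCoeff, ha]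

theorem gammaCoeff_natCast (d : Matrix I I ℤ) (q : K) (i : I) (n : ℕ) (h : ColoredPoly K I) :
    gammaCoeff d q i n h = PowerSeries.coeff n (gammaHom d q i h) := by
  simp [gammaCoeff]

theorem gammaHom_X (d : Matrix I I ℤ) (q : K) (i : I) (y : I × ℤ) :
    gammaHom d q i (MvPolynomial.X y) =
      PowerSeries.X ^ colorShift i y.1 * gammaUnit d q i (MvPolynomial.X y) := by
  simp [gammaHom]

theorem gammaUnit_X (d : Matrix I I ℤ) (q : K) (i : I) (y : I × ℤ) :
    gammaUnit d q i (MvPolynomial.X y) = PowerSeries.mk fun m =>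
      factorCoeff d q i y.1 m • MvPolynomial.X (y.1, y.2 - m) := by
  simp [gammaUnit]

theorem gammaCoeff_X (d : Matrix I I ℤ) (q : K) (i : I) (y : I × ℤ) (a : ℤ) :
    gammaCoeff d q i a (MvPolynomial.X y) =
      factorCoeff d q i y.1 (a - colorShift i y.1) •
        MvPolynomial.X (y.1, y.2 - (a - colorShift i y.1)) := by
  rcases lt_or_ge a 0 with ha | ha
  · rw [gammaCoeff_of_neg _ _ _ ha, factorCoeff_of_neg _ _ _ _ (by omega), zero_smul]
  · obtain ⟨n, rfl⟩ := Int.eq_ofNat_of_zero_le ha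
    rw [gammaCoeff_natCast, gammaHom_X, gammaUnit_X, PowerSeries.coeff_X_pow_mul']
    split_ifs with h
    · rw [PowerSeries.coeff_mk, Nat.cast_sub h]
    · rw [factorCoeff_of_neg _ _ _ _ (by omega), zero_smul]

theorem gammaCoeff_C (d : Matrix I I ℤ) (q : K) (i : I) (a : ℤ) (c : K) :
    gammaCoeff d q i a (MvPolynomial.C c) = if a = 0 then MvPolynomial.C c else 0 := by
  rcases lt_or_ge a 0 with ha | ha
  · rw [gammaCoeff_of_neg _ _ _ ha, if_neg ha.ne]
  obtain ⟨n, rfl⟩ := Int.eq_ofNat_of_zero_le ha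
  rw [gammaCoeff_natCast, ← MvPolynomial.algebraMap_eq, AlgHom.commutes,
    IsScalarTower.algebraMap_apply K (ColoredPoly K I) (PowerSeries (ColoredPoly K I)),
    PowerSeries.algebraMap_apply]
  simp [PowerSeries.coeff_C]

theorem gammaCoeff_sub_natCast (d : Matrix I I ℤ) (q : K) (i : I) (n e : ℕ)
    (f : ColoredPoly K I) :
    gammaCoeff d q i (n - e) f = PowerSeries.coeff n (PowerSeries.X ^ e * gammaHom d q i f) := by
  rw [PowerSeries.coeff_X_pow_mul']
  split_ifs with h
  · rw [← gammaCoeff_natCast, Nat.cast_sub h]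
  · rw [gammaCoeff_of_neg _ _ _ (by omega)]

/-- A delay by `e` may be charged to either factor of a product; the product rule for derivatives
needs both forms. -/
theorem gammaCoeff_mul_left (d : Matrix I I ℤ) (q : K) (i : I) (n e : ℕ)
    (f g : ColoredPoly K I) :
    gammaCoeff d q i (n - e) (f * g) = ∑ x ∈ Finset.HasAntidiagonal.antidiagonal n,
      gammaCoeff d q i (x.1 - e) f * gammaCoeff d q i x.2 g := by
  simp only [gammaCoeff_sub_natCast, gammaCoeff_natCast, map_mul, ← mul_assoc]
  rw [PowerSeries.coeff_mul]

theorem gammaCoeff_mul_right (d : Matrix I I ℤ) (q : K) (i : I) (n e : ℕ)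
    (f g : ColoredPoly K I) :
    gammaCoeff d q i (n - e) (f * g) = ∑ x ∈ Finset.HasAntidiagonal.antidiagonal n,
      gammaCoeff d q i x.1 f * gammaCoeff d q i (x.2 - e) g := by
  simp only [gammaCoeff_sub_natCast, gammaCoeff_natCast, map_mul]
  rw [mul_left_comm, PowerSeries.coeff_mul]

theorem gammaCoeff_mul (d : Matrix I I ℤ) (q : K) (i : I) (n : ℕ) (f g : ColoredPoly K I) :
    gammaCoeff d q i n (f * g) = ∑ x ∈ Finset.HasAntidiagonal.antidiagonal n,
      gammaCoeff d q i x.1 f * gammaCoeff d q i x.2 g := by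
  simpa using gammaCoeff_mul_left d q i n 0 f g

/-- On a variable both orders give the same scalar and the same total shift of the exponent;
multiplicativity extends this to all polynomials. -/
theorem gammaCoeff_comm (d : Matrix I I ℤ) (q : K) (i j : I) (a b : ℤ) (h : ColoredPoly K I) :
    gammaCoeff d q j b (gammaCoeff d q i a h) = gammaCoeff d q i a (gammaCoeff d q j b h) := by
  rcases lt_or_ge a 0 with ha | ha
  · simp [gammaCoeff_of_neg _ _ _ ha]
  rcases lt_or_ge b 0 with hb | hb
  · simp [gammaCoeff_of_neg _ _ _ hb]
  obtain ⟨n, rfl⟩ := Int.eq_ofNat_of_zero_le ha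
  obtain ⟨m, rfl⟩ := Int.eq_ofNat_of_zero_le hb
  clear ha hb
  induction h using MvPolynomial.induction_on generalizing n m with
  | C c =>
    simp only [gammaCoeff_C]
    split_ifs with h1 h2 h2 <;>
      simp only [gammaCoeff_C, h1, h2, map_zero, if_true, if_false]
  | add f g hf hg => simp only [map_add, hf, hg]
  | mul_X f y hf =>
    have hy : ∀ a b : ℤ, gammaCoeff d q j b (gammaCoeff d q i a (MvPolynomial.X y)) =
        gammaCoeff d q i a (gammaCoeff d q j b (MvPolynomial.X y)) := by
      intro a b
      simp only [gammaCoeff_X, map_smul, smul_smul]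
      rw [mul_comm, sub_right_comm]
    simp only [gammaCoeff_mul, map_sum]
    rw [Finset.sum_comm]
    simp only [hf, hy]

theorem pderiv_gammaCoeff_X (d : Matrix I I ℤ) (q : K) (i j : I) (p : ℤ) (y : I × ℤ) (n : ℤ) :
    MvPolynomial.pderiv (j, p) (gammaCoeff d q i n (MvPolynomial.X y)) =
      ∑ᶠ p' : ℤ, factorCoeff d q i j (p' - p) • gammaCoeff d q i (n - colorShift i j - (p' - p))
        (MvPolynomial.pderiv (j, p') (MvPolynomial.X y)) := by
  obtain ⟨j', p₀⟩ := y
  rw [gammaCoeff_X]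
  simp only
  by_cases hj : j' = j
  · subst hj
    rw [finsum_eq_single _ p₀, MvPolynomial.pderiv_X_self, ← MvPolynomial.C_1, gammaCoeff_C,
      Derivation.map_smul]
    · by_cases h : n - colorShift i j' - (p₀ - p) = 0
      · have h1 : n - colorShift i j' = p₀ - p := by omega
        rw [if_pos h, h1, sub_sub_cancel, MvPolynomial.pderiv_X_self, MvPolynomial.C_1]
      · rw [if_neg h, MvPolynomial.pderiv_X_of_ne, smul_zero, smul_zero]
        simp only [ne_eq, Prod.mk.injEq, true_and]
        omega
    · intro p' hp'
      rw [MvPolynomial.pderiv_X_of_ne (by simpa using hp'.symm), map_zero, smul_zero]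
  · rw [finsum_eq_zero_of_forall_eq_zero, Derivation.map_smul, MvPolynomial.pderiv_X_of_ne,
      smul_zero]
    · simp [hj]
    · intro p'
      rw [MvPolynomial.pderiv_X_of_ne (by simp [hj]), map_zero, smul_zero]

/-- The chain rule for the action of a partial derivative on a coefficient of `Γ_i(z) h`. -/
theorem pderiv_gammaCoeff (d : Matrix I I ℤ) (q : K) (i j : I) (p a : ℤ) (h : ColoredPoly K I) :
    MvPolynomial.pderiv (j, p) (gammaCoeff d q i a h) =
      ∑ᶠ p' : ℤ, factorCoeff d q i j (p' - p) •
        gammaCoeff d q i (a - colorShift i j - (p' - p)) (MvPolynomial.pderiv (j, p') h) := by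
  rcases lt_or_ge a 0 with ha | ha
  · rw [gammaCoeff_of_neg _ _ _ ha, map_zero, finsum_eq_zero_of_forall_eq_zero]
    intro p'
    rcases lt_or_ge (p' - p) 0 with hp | hp
    · rw [factorCoeff_of_neg _ _ _ _ hp, zero_smul]
    · rw [gammaCoeff_of_neg _ _ _ (by omega), smul_zero]
  obtain ⟨n, rfl⟩ := Int.eq_ofNat_of_zero_le ha
  clear ha
  have fin : ∀ (n : ℤ) (f : ColoredPoly K I), Function.HasFiniteSupport fun p' : ℤ =>
      factorCoeff d q i j (p' - p) •
        gammaCoeff d q i (n - colorShift i j - (p' - p)) (MvPolynomial.pderiv (j, p') f) :=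
    fun n f => finite_support_of_pderiv j f fun p' hp' => by rw [hp', map_zero, smul_zero]
  induction h using MvPolynomial.induction_on generalizing n with
  | C c =>
    rw [gammaCoeff_C, finsum_eq_zero_of_forall_eq_zero (by simp)]
    split_ifs <;> simp
  | add f g hf hg =>
    simp only [map_add, smul_add]
    rw [finsum_add_distrib (fin n f) (fin n g), hf, hg]
  | mul_X f y hf =>
    have hy := pderiv_gammaCoeff_X d q i j p y
    simp only [gammaCoeff_mul, map_sum, Derivation.leibniz, smul_eq_mul]
    have term : ∀ p' : ℤ, factorCoeff d q i j (p' - p) •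
        gammaCoeff d q i (n - colorShift i j - (p' - p))
          (f * MvPolynomial.pderiv (j, p') (MvPolynomial.X y) +
            MvPolynomial.X y * MvPolynomial.pderiv (j, p') f) =
        ∑ x ∈ Finset.HasAntidiagonal.antidiagonal n,
          (gammaCoeff d q i x.1 f * (factorCoeff d q i j (p' - p) •
            gammaCoeff d q i (x.2 - colorShift i j - (p' - p))
              (MvPolynomial.pderiv (j, p') (MvPolynomial.X y))) +
          gammaCoeff d q i x.2 (MvPolynomial.X y) * (factorCoeff d q i j (p' - p) •
            gammaCoeff d q i (x.1 - colorShift i j - (p' - p))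
              (MvPolynomial.pderiv (j, p') f))) := by
      intro p'
      -- Negative differences have zero coefficient; otherwise color shift and difference merge into
      -- one natural-number delay.
      rcases lt_or_ge (p' - p) 0 with hp | hp
      · simp [factorCoeff_of_neg _ _ _ _ hp]
      obtain ⟨r, hr⟩ := Int.eq_ofNat_of_zero_le hp
      have e : ∀ m : ℕ, (m : ℤ) - colorShift i j - (p' - p) = m - (colorShift i j + r : ℕ) := by
        intro m; rw [hr]; push_cast; ring
      simp only [e]
      rw [mul_comm (MvPolynomial.X y), map_add, gammaCoeff_mul_right, gammaCoeff_mul_left,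
        ← Finset.sum_add_distrib, Finset.smul_sum]
      refine Finset.sum_congr rfl fun x _ => ?_
      rw [smul_add, mul_smul_comm, mul_smul_comm, mul_comm (gammaCoeff d q i x.2 _)]
    rw [finsum_congr term, finsum_sum_comm]
    · refine Finset.sum_congr rfl fun x _ => ?_
      rw [finsum_add_distrib, ← mul_finsum, ← mul_finsum, hf, hy]
      · exact (fin x.2 (MvPolynomial.X y)).subset fun p' hp' h => hp' (by
          simp only at h ⊢
          rw [h, mul_zero])
      · exact (fin x.1 f).subset fun p' hp' h => hp' (by
          simp only at h ⊢
          rw [h, mul_zero])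
    · intro x _
      refine ((fin x.2 (MvPolynomial.X y)).union (fin x.1 f)).subset fun p' hp' => ?_
      by_contra h
      simp only [Set.mem_union, Function.mem_support, not_or, not_not] at h
      exact hp' (by simp only [h, mul_zero, add_zero])

/-! ### The operators for e_{i,k} and their quadratic relation -/

/-- The operator representing `e_{i,k}`. -/
noncomputable def peel (d : Matrix I I ℤ) (q : K) (i : I) (k : ℤ) :
    ColoredPoly K I →ₗ[K] ColoredPoly K I where
  toFun f := ∑ᶠ p : ℤ, gammaCoeff d q i (k - p) (MvPolynomial.pderiv (i, p) f)
  map_add' f g := by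
    simp only [map_add]
    exact finsum_add_distrib (finite_support_of_pderiv i f fun p hp => by rw [hp, map_zero])
      (finite_support_of_pderiv i g fun p hp => by rw [hp, map_zero])
  map_smul' c f := by
    simp only [Derivation.map_smul, map_smul, RingHom.id_apply]
    exact (smul_finsum c _).symm

theorem peel_apply (d : Matrix I I ℤ) (q : K) (i : I) (k : ℤ) (f : ColoredPoly K I) :
    peel d q i k f = ∑ᶠ p : ℤ, gammaCoeff d q i (k - p) (MvPolynomial.pderiv (i, p) f) := rfl

theorem peel_eq_sum (d : Matrix I I ℤ) (q : K) (i : I) (k : ℤ) (f : ColoredPoly K I)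
    {A : Finset ℤ} (hA : ∀ p, p ∉ A → MvPolynomial.pderiv (i, p) f = 0) :
    peel d q i k f = ∑ p ∈ A, gammaCoeff d q i (k - p) (MvPolynomial.pderiv (i, p) f) := by
  rw [peel_apply]
  refine finsum_eq_sum_of_support_subset _ fun p hp => ?_
  by_contra h
  exact hp (by simp [hA p h])

/-- The coefficient of the normally ordered product `Γ_j(w) Γ_i(z)` times the interaction factor
of `i` and `j`. -/
noncomputable def pairCoeff (d : Matrix I I ℤ) (q : K) (i j : I) (a b : ℤ)
    (h : ColoredPoly K I) : ColoredPoly K I :=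
  ∑ᶠ r : ℤ, factorCoeff d q i j r •
    gammaCoeff d q j (b + r) (gammaCoeff d q i (a - colorShift i j - r) h)

theorem finite_pairCoeff (d : Matrix I I ℤ) (q : K) (i j : I) (a b : ℤ)
    (h : ColoredPoly K I) : Function.HasFiniteSupport fun r : ℤ => factorCoeff d q i j r •
      gammaCoeff d q j (b + r) (gammaCoeff d q i (a - colorShift i j - r) h) := by
  refine (Set.finite_Icc (0 : ℤ) a).subset fun r hr => ?_
  by_contra hr'
  refine hr ?_
  rw [Set.mem_Icc, not_and_or] at hr'
  rcases hr' with hr' | hr'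
  · simp [factorCoeff_of_neg d q i j (not_le.1 hr')]
  · simp [gammaCoeff_of_neg d q i (show a - colorShift i j - r < 0 by omega)]

/-- Normal ordering: the derivative in the operator for e_{j,l} passes Γ_i(z) at the price of the
interaction factor. -/
theorem peel_gammaCoeff (d : Matrix I I ℤ) (q : K) (i j : I) (a l : ℤ) (h : ColoredPoly K I)
    {A : Finset ℤ} (hA : ∀ p, p ∉ A → MvPolynomial.pderiv (j, p) h = 0) :
    peel d q j l (gammaCoeff d q i a h) =
      ∑ p ∈ A, pairCoeff d q i j a (l - p) (MvPolynomial.pderiv (j, p) h) := by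
  have shift : ∀ p' p : ℤ, gammaCoeff d q j (l - (p' - p)) (factorCoeff d q i j p •
      gammaCoeff d q i (a - colorShift i j - p) (MvPolynomial.pderiv (j, p') h)) =
      factorCoeff d q i j p • gammaCoeff d q j (l - p' + p)
        (gammaCoeff d q i (a - colorShift i j - p) (MvPolynomial.pderiv (j, p') h)) := by
    intro p' p
    rw [map_smul, sub_add]
  have key : ∀ p, MvPolynomial.pderiv (j, p) (gammaCoeff d q i a h) =
      ∑ p' ∈ A, factorCoeff d q i j (p' - p) •
        gammaCoeff d q i (a - colorShift i j - (p' - p)) (MvPolynomial.pderiv (j, p') h) := by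
    intro p
    rw [pderiv_gammaCoeff]
    refine finsum_eq_sum_of_support_subset _ fun p' hp => ?_
    by_contra h'
    exact hp (by simp [hA p' h'])
  have reindex : ∀ p' : ℤ, ∀ F : ℤ → ColoredPoly K I,
      ∑ᶠ p : ℤ, F p = ∑ᶠ p : ℤ, F (p' - p) :=
    fun p' F => (finsum_comp_equiv (Equiv.subLeft p')).symm
  rw [peel_apply]
  simp only [key, map_sum]
  rw [finsum_sum_comm]
  · refine Finset.sum_congr rfl fun p' _ => ?_
    rw [reindex p', pairCoeff]
    refine finsum_congr fun p => ?_
    rw [sub_sub_cancel, shift]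
  · intro p' _
    refine ((finite_pairCoeff d q i j a (l - p') (MvPolynomial.pderiv (j, p') h)).preimage
      (f := fun p => p' - p) (sub_right_injective.injOn)).subset fun p hp => ?_
    simp only [Set.mem_preimage, Function.mem_support] at hp ⊢
    rwa [← shift, sub_sub_cancel]

theorem peel_peel (d : Matrix I I ℤ) (q : K) (i j : I) (k l : ℤ) (f : ColoredPoly K I)
    {A : Finset ℤ} (hA : ∀ i p, p ∉ A → MvPolynomial.pderiv (i, p) f = 0) :
    peel d q j l (peel d q i k f) = ∑ p ∈ A, ∑ p' ∈ A, pairCoeff d q i j (k - p) (l - p')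
      (MvPolynomial.pderiv (j, p') (MvPolynomial.pderiv (i, p) f)) := by
  rw [peel_eq_sum d q i k f (hA i), map_sum]
  refine Finset.sum_congr rfl fun p _ => ?_
  rw [peel_gammaCoeff]
  intro p' hp'
  rw [pderiv_comm, hA j p' hp', map_zero]

/-- Multiplication by z - q^{d_ij} w telescopes the geometric series: only r = 0 survives, and r = 1
when i = j. -/
theorem pairCoeff_sub (d : Matrix I I ℤ) (q : K) (i j : I) (a b : ℤ) (h : ColoredPoly K I) :
    pairCoeff d q i j (a + 1) b h - q ^ d i j • pairCoeff d q i j a (b + 1) h =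
      orderSign K i j • gammaCoeff d q j b (gammaCoeff d q i (a + 1 - colorShift i j) h) -
        if i = j then gammaCoeff d q j (b + 1) (gammaCoeff d q i a h) else 0 := by
  set t : ℤ → ColoredPoly K I := fun r =>
    gammaCoeff d q j (b + r) (gammaCoeff d q i (a + 1 - colorShift i j - r) h) with ht
  have h1 : pairCoeff d q i j a (b + 1) h = ∑ᶠ r : ℤ, factorCoeff d q i j (r - 1) • t r := by
    rw [pairCoeff, ← finsum_comp_equiv (f := fun r => factorCoeff d q i j (r - 1) • t r)
      (Equiv.addRight (1 : ℤ))]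
    refine finsum_congr fun r => ?_
    simp only [ht, Equiv.coe_addRight, add_sub_cancel_right]
    rw [show b + (r + 1) = b + 1 + r by ring, show a + 1 - (colorShift i j : ℤ) - (r + 1) =
      a - colorShift i j - r by ring]
  have f1 := finite_pairCoeff d q i j (a + 1) b h
  have f2 : Function.HasFiniteSupport fun r : ℤ => factorCoeff d q i j (r - 1) • t r := by
    refine ((finite_pairCoeff d q i j a (b + 1) h).preimage
      (f := fun r => r - 1) (sub_left_injective.injOn)).subset fun r hr => ?_
    simp only [Set.mem_preimage, Function.mem_support, ht] at hr ⊢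
    convert hr using 4 <;> ring_nf
  rw [h1, smul_finsum, pairCoeff, ← finsum_sub_distrib f1 (by
    refine f2.subset fun r hr hr' => hr ?_
    simp only at hr' ⊢
    rw [hr', smul_zero])]
  have h2 : ∀ r : ℤ, factorCoeff d q i j r • t r - q ^ d i j • factorCoeff d q i j (r - 1) • t r =
      (if r = 0 then orderSign K i j • t 0 else 0) - if r = 1 then (if i = j then t 1 else 0)
        else 0 := by
    intro r
    rw [smul_smul, ← sub_smul, factorCoeff_sub]
    by_cases r0 : r = 0
    · simp [r0]
    · by_cases r1 : r = 1 <;> by_cases hij : i = j <;> simp [r0, r1, hij]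
  have h3 : ∀ (r0 : ℤ) (c : ColoredPoly K I),
      Function.HasFiniteSupport fun r : ℤ => if r = r0 then c else 0 := fun r0 c =>
    (Set.finite_singleton r0).subset fun r hr => by
      by_contra hr'
      exact hr (if_neg hr')
  rw [finsum_congr h2, finsum_sub_distrib (h3 _ _) (h3 _ _),
    finsum_eq_single _ 0 (fun r hr => if_neg hr), finsum_eq_single _ 1 (fun r hr => if_neg hr),
    if_pos rfl, if_pos rfl, ht]
  by_cases hij : i = j <;> simp [hij, colorShift]

/-- After clearing denominators, exchanging (i, z) and (j, w) negates what remains: z - w changes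
sign if i = j, and `orderSign` does if i ≠ j. -/
theorem pairCoeff_relation (d : Matrix I I ℤ) (hd : ∀ i j, d i j = d j i) (q : K) (i j : I)
    (a b : ℤ) (h : ColoredPoly K I) :
    pairCoeff d q i j (a + 1) b h - q ^ d i j • pairCoeff d q i j a (b + 1) h =
      q ^ d i j • pairCoeff d q j i b (a + 1) h - pairCoeff d q j i (b + 1) a h := by
  rw [pairCoeff_sub, ← neg_sub (pairCoeff d q j i (b + 1) a h), hd i j, pairCoeff_sub]
  by_cases hij : i = j
  · subst hij
    simp only [colorShift, if_true, Nat.cast_zero, sub_zero]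
    rw [gammaCoeff_comm d q i i (b + 1) a, gammaCoeff_comm d q i i b (a + 1)]
    simp [orderSign]
  · rw [orderSign_swap hij]
    simp only [colorShift, hij, Ne.symm hij, if_false, Nat.cast_one, add_sub_cancel_right, sub_zero]
    rw [gammaCoeff_comm d q i j]
    simp

theorem peel_relation (d : Matrix I I ℤ) (hd : ∀ i j, d i j = d j i) (q : K) (i j : I)
    (k l : ℤ) (f : ColoredPoly K I) :
    peel d q j l (peel d q i (k + 1) f) - q ^ d i j • peel d q j (l + 1) (peel d q i k f) =
      q ^ d i j • peel d q i (k + 1) (peel d q j l f) - peel d q i k (peel d q j (l + 1) f) := by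
  have hA : ∀ i p, p ∉ f.vars.image Prod.snd → MvPolynomial.pderiv (i, p) f = 0 := by
    intro i p hp
    refine MvPolynomial.pderiv_eq_zero_of_notMem_vars fun h' => hp ?_
    simpa using ⟨i, h'⟩
  simp only [peel_peel d q _ _ _ _ f hA]
  rw [Finset.sum_comm (f := fun p p' => pairCoeff d q j i (l - p) (k + 1 - p') _),
    Finset.sum_comm (f := fun p p' => pairCoeff d q j i (l + 1 - p) (k - p') _)]
  simp only [Finset.smul_sum, ← Finset.sum_sub_distrib]
  refine Finset.sum_congr rfl fun p _ => Finset.sum_congr rfl fun p' _ => ?_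
  rw [pderiv_comm (i, p), add_sub_right_comm, add_sub_right_comm]
  exact pairCoeff_relation d hd q i j _ _ _

/-- The representation of the quadratic algebra by operators on the right. -/
noncomputable def peelRep (d : Matrix I I ℤ) (hd : ∀ i j, d i j = d j i) (q : K) :
    QuadAlgebra d q →ₐ[K] (Module.End K (ColoredPoly K I))ᵐᵒᵖ :=
  RingQuot.liftAlgHom K ⟨FreeAlgebra.lift K fun x => MulOpposite.op (peel d q x.1 x.2), by
    rintro _ _ ⟨i, j, k, l⟩
    simp only [freeGen, map_sub, map_smul, map_mul, FreeAlgebra.lift_ι_apply]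
    apply MulOpposite.unop_injective
    refine LinearMap.ext fun f => ?_
    simpa using peel_relation d hd q i j k l f⟩

theorem peelRep_monomial_cons (d : Matrix I I ℤ) (hd : ∀ i j, d i j = d j i) (q : K)
    (x : I × ℤ) (w : Word I) (f : ColoredPoly K I) :
    (peelRep d hd q (monomial d q (x :: w))).unop f =
      (peelRep d hd q (monomial d q w)).unop (peel d q x.1 x.2 f) := by
  rw [monomial_cons, map_mul, MulOpposite.unop_mul, Module.End.mul_apply]
  simp [peelRep, gen, freeGen]

end Representation

/-! ### Triangular pairing with test monomials -/

section Triangularity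

variable {K : Type*} [Field K] {I : Type*}

/-- The product of the variables indexed by a list. -/
noncomputable def listMonomial (K : Type*) [Field K] {I : Type*} (P : List (I × ℤ)) :
    ColoredPoly K I :=
  (P.map MvPolynomial.X).prod

theorem listMonomial_cons (x : I × ℤ) (P : List (I × ℤ)) :
    listMonomial K (x :: P) = MvPolynomial.X x * listMonomial K P := by
  simp [listMonomial]

theorem listMonomial_perm {P Q : List (I × ℤ)} (h : P.Perm Q) :
    listMonomial K P = listMonomial K Q := (h.map _).prod_eq

variable [LinearOrder I]

theorem pderiv_listMonomial (x : I × ℤ) (P : List (I × ℤ)) :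
    MvPolynomial.pderiv x (listMonomial K P) = P.count x • listMonomial K (P.erase x) := by
  induction P with
  | nil => simp [listMonomial]
  | cons y P ih =>
    rw [listMonomial_cons, Derivation.leibniz, ih]
    by_cases hxy : y = x
    · subst hxy
      rw [List.erase_cons_head, List.count_cons_self, MvPolynomial.pderiv_X_self]
      by_cases hy : y ∈ P
      · rw [listMonomial_perm (List.perm_cons_erase hy), listMonomial_cons]
        simp only [smul_eq_mul, nsmul_eq_mul]
        push_cast
        ring
      · rw [List.count_eq_zero_of_not_mem hy]
        simp
    · rw [List.erase_cons_tail (by simpa using hxy), List.count_cons_of_ne hxy,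
        MvPolynomial.pderiv_X_of_ne hxy, listMonomial_cons]
      simp only [smul_eq_mul, nsmul_eq_mul]
      ring

/-- The number of letters of color different from `i`. -/
def otherCount (i : I) (P : List (I × ℤ)) : ℕ := P.countP fun x => x.1 ≠ i

theorem otherCount_cons (i : I) (x : I × ℤ) (P : List (I × ℤ)) :
    otherCount i (x :: P) = otherCount i P + if x.1 ≠ i then 1 else 0 := by
  simp [otherCount, List.countP_cons]

theorem gammaHom_listMonomial (d : Matrix I I ℤ) (q : K) (i : I) (P : List (I × ℤ)) :
    gammaHom d q i (listMonomial K P) =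
      PowerSeries.X ^ otherCount i P * gammaUnit d q i (listMonomial K P) := by
  induction P with
  | nil => simp [listMonomial, otherCount]
  | cons x P ih =>
    have h : otherCount i (x :: P) = colorShift i x.1 + otherCount i P := by
      rw [otherCount_cons, colorShift, add_comm]
      by_cases h : x.1 = i
      · simp [h]
      · simp [h, Ne.symm h]
    rw [listMonomial_cons, map_mul, map_mul, ih, gammaHom_X, h, pow_add]
    ring

theorem exists_constantCoeff_gammaUnit (d : Matrix I I ℤ) (q : K) (i : I) (P : List (I × ℤ)) :
    ∃ c : K, c ≠ 0 ∧ PowerSeries.coeff 0 (gammaUnit d q i (listMonomial K P)) =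
      c • listMonomial K P := by
  induction P with
  | nil => exact ⟨1, one_ne_zero, by simp [listMonomial]⟩
  | cons x P ih =>
    obtain ⟨c, hc, h⟩ := ih
    refine ⟨orderSign K i x.1 * c, mul_ne_zero (orderSign_ne_zero _ _) hc, ?_⟩
    rw [listMonomial_cons, map_mul, PowerSeries.coeff_mul,
      Finset.Nat.antidiagonal_zero, Finset.sum_singleton, h, gammaUnit_X,
      PowerSeries.coeff_mk]
    simp [factorCoeff_zero, mul_smul, smul_comm c]

theorem gammaCoeff_listMonomial_of_lt (d : Matrix I I ℤ) (q : K) (i : I) (P : List (I × ℤ))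
    {a : ℤ} (ha : a < otherCount i P) : gammaCoeff d q i a (listMonomial K P) = 0 := by
  rcases lt_or_ge a 0 with h | h
  · exact gammaCoeff_of_neg _ _ _ h _
  obtain ⟨n, rfl⟩ := Int.eq_ofNat_of_zero_le h
  rw [gammaCoeff_natCast, gammaHom_listMonomial, PowerSeries.coeff_X_pow_mul',
    if_neg (by omega)]

theorem exists_gammaCoeff_listMonomial (d : Matrix I I ℤ) (q : K) (i : I) (P : List (I × ℤ)) :
    ∃ c : K, c ≠ 0 ∧ gammaCoeff d q i (otherCount i P) (listMonomial K P) =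
      c • listMonomial K P := by
  obtain ⟨c, hc, h⟩ := exists_constantCoeff_gammaUnit d q i P
  refine ⟨c, hc, ?_⟩
  rw [gammaCoeff_natCast, gammaHom_listMonomial, PowerSeries.coeff_X_pow_mul', if_pos le_rfl,
    Nat.sub_self, h]

theorem otherCount_erase {i : I} {p : ℤ} {P : List (I × ℤ)} (h : (i, p) ∈ P) :
    otherCount i (P.erase (i, p)) = otherCount i P := by
  have := (List.perm_cons_erase h).countP_eq (fun x : I × ℤ => decide (x.1 ≠ i))
  simpa [otherCount] using this.symm

theorem gammaCoeff_pderiv_listMonomial_eq_zero (d : Matrix I I ℤ) (q : K) (i : I) (a p : ℤ)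
    (P : List (I × ℤ)) (h : (i, p) ∈ P → a < otherCount i P) :
    gammaCoeff d q i a (MvPolynomial.pderiv (i, p) (listMonomial K P)) = 0 := by
  rw [pderiv_listMonomial]
  by_cases hp : (i, p) ∈ P
  · rw [map_nsmul, gammaCoeff_listMonomial_of_lt, smul_zero]
    rw [otherCount_erase hp]
    exact h hp
  · rw [List.count_eq_zero_of_not_mem hp, zero_smul, map_zero]

/-- Removing y_{i,p} contributes z^{-p}, and Γ_i(z) contributes at least one z^{-1} per remaining
letter of another color, so k is out of reach. -/
theorem peel_listMonomial_eq_zero (d : Matrix I I ℤ) (q : K) (i : I) (k : ℤ)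
    (P : List (I × ℤ)) (h : ∀ p, (i, p) ∈ P → k < p + otherCount i P) :
    peel d q i k (listMonomial K P) = 0 := by
  rw [peel_apply, finsum_eq_zero_of_forall_eq_zero]
  intro p
  refine gammaCoeff_pderiv_listMonomial_eq_zero d q i _ p P fun hp => ?_
  have := h p hp
  omega

/-- The extremal exponent: only the smallest p of color `i` reaches it, and only through the leading
coefficient of Γ_i(z), which is a nonzero scalar. -/
theorem exists_peel_listMonomial [CharZero K] (d : Matrix I I ℤ) (q : K) (i : I) (p : ℤ)
    (P : List (I × ℤ)) (h : ∀ p', (i, p') ∈ P → p ≤ p') :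
    ∃ c : K, c ≠ 0 ∧ peel d q i (p + otherCount i P) (listMonomial K ((i, p) :: P)) =
      c • listMonomial K P := by
  obtain ⟨c, hc, hP⟩ := exists_gammaCoeff_listMonomial d q i P
  -- The multiplicity of y_{i,p} comes from differentiating its power; it is nonzero in
  -- characteristic zero.
  refine ⟨((i, p) :: P).count (i, p) * c, mul_ne_zero ?_ hc, ?_⟩
  · rw [List.count_cons_self]
    exact_mod_cast Nat.succ_ne_zero (P.count (i, p))
  · rw [peel_apply, finsum_eq_single _ p, pderiv_listMonomial, map_nsmul, add_sub_cancel_left,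
      List.erase_cons_head, hP, mul_smul, Nat.cast_smul_eq_nsmul]
    intro p' hp'
    refine gammaCoeff_pderiv_listMonomial_eq_zero d q i _ p' _ fun hp => ?_
    have h1 : (i, p') ∈ P := by simpa [hp'] using hp
    have h2 := h p' h1
    simp only [otherCount_cons, ne_eq, not_true_eq_false, if_false, add_zero]
    omega

/-- The list of variables whose product pairs triangularly with the monomial of a word. -/
def leadingList : List (I × ℤ) → List (I × ℤ)
  | [] => []
  | x :: w => (x.1, x.2 - otherCount x.1 w) :: leadingList w

theorem otherCount_leadingList (i : I) (w : Word I) :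
    otherCount i (leadingList w) = otherCount i w := by
  induction w with
  | nil => rfl
  | cons x w ih => simp only [leadingList, otherCount_cons, ih]

/-- In `leadingList` the count of later letters of other colors is already subtracted, so this is
the non-increasing condition between the first letter and each later one. -/
theorem leadingList_bound {x : I × ℤ} {w : Word I} (h : (x :: w).IsChain StepLE) :
    ∀ y ∈ leadingList w, x.2 < y.2 + otherCount y.1 (x :: w) ∨
      (x.2 = y.2 + otherCount y.1 (x :: w) ∧ x.1 ≥ y.1) := by
  induction w generalizing x with
  | nil => simp [leadingList]
  | cons z w ih =>
    rw [List.isChain_cons_cons] at h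
    intro y hy
    rw [otherCount_cons]
    push_cast
    refine h.1.trans_count ?_
    rw [leadingList, List.mem_cons] at hy
    rcases hy with rfl | hy
    · right
      simp [otherCount_cons]
    · exact ih h.2 y hy

theorem peelRep_leadingList_ne_zero [CharZero K] (d : Matrix I I ℤ) (hd : ∀ i j, d i j = d j i)
    (q : K) {w : Word I} (hw : w.IsChain StepLE) :
    (peelRep d hd q (monomial d q w)).unop (listMonomial K (leadingList w)) ≠ 0 := by
  induction w with
  | nil => simp [monomial, leadingList, listMonomial]
  | cons x w ih =>
    obtain ⟨c, hc, h⟩ := exists_peel_listMonomial d q x.1 (x.2 - otherCount x.1 w)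
      (leadingList w) fun p' hp' => by
        have := leadingList_bound hw _ hp'
        simp only [otherCount_cons, ne_eq, not_true_eq_false, if_false, add_zero] at this
        omega
    rw [otherCount_leadingList, sub_add_cancel] at h
    rw [peelRep_monomial_cons, leadingList, h, map_smul]
    exact smul_ne_zero hc (ih hw.tail)

theorem wordLE_of_peelRep_leadingList_ne_zero [CharZero K] (d : Matrix I I ℤ)
    (hd : ∀ i j, d i j = d j i) (q : K) {w v : Word I} (hw : w.IsChain StepLE)
    (h : (peelRep d hd q (monomial d q v)).unop (listMonomial K (leadingList w)) ≠ 0) :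
    WordLE v w := by
  induction v generalizing w with
  | nil =>
    cases w with
    | nil => exact Or.inl rfl
    | cons x w => exact Or.inr .nil
  | cons y v ih =>
    rw [peelRep_monomial_cons] at h
    cases w with
    | nil =>
      rw [leadingList, peel_listMonomial_eq_zero _ _ _ _ _ (by simp), map_zero] at h
      exact absurd rfl h
    | cons x w =>
      -- A smaller first letter settles the comparison, an equal one is peeled off on both sides,
      -- and a larger one kills the test monomial.
      rcases trichotomous_of LetterLT y x with hyx | rfl | hxy
      · exact Or.inr (.rel hyx)
      · obtain ⟨c, hc, hcw⟩ := exists_peel_listMonomial d q y.1 (y.2 - otherCount y.1 w)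
          (leadingList w) fun p' hp' => by
            have := leadingList_bound hw _ hp'
            simp only [otherCount_cons, ne_eq, not_true_eq_false, if_false, add_zero] at this
            omega
        rw [otherCount_leadingList, sub_add_cancel] at hcw
        rw [leadingList, hcw, map_smul] at h
        rcases ih hw.tail (right_ne_zero_of_smul h) with rfl | h'
        · exact Or.inl rfl
        · exact Or.inr (.cons h')
      · rw [peel_listMonomial_eq_zero, map_zero] at h
        · exact absurd rfl h
        intro p hp
        rw [otherCount_leadingList]
        have hb : x.2 < p + otherCount y.1 (x :: w) ∨
            (x.2 = p + otherCount y.1 (x :: w) ∧ x.1 ≥ y.1) := by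
          rw [leadingList, List.mem_cons] at hp
          rcases hp with hp | hp
          · rw [Prod.mk.injEq] at hp
            right
            rw [hp.2, hp.1]
            simp [otherCount_cons]
          · exact leadingList_bound hw _ hp
        unfold LetterLT at hxy
        rcases hxy with h1 | ⟨h1, h2⟩
        · rcases hb with hb | hb <;> omega
        · rcases hb with hb | hb
          · omega
          · exact absurd h2 (not_lt.2 hb.2)

/-- In a vanishing combination, evaluate on the test monomial of the smallest word in the support:
by triangularity only that word's term survives. -/
theorem linearIndependent_nonIncreasing [CharZero K] (d : Matrix I I ℤ)
    (hd : ∀ i j, d i j = d j i) (q : K) :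
    LinearIndependent K fun w : {w : Word I // NonIncreasing w} => monomial d q w.1 := by
  rw [linearIndependent_iff]
  intro l hl
  by_contra hne
  have wf : Set.WellFoundedOn ((fun w : {w : Word I // NonIncreasing w} => w.1) '' l.support)
      (List.Lex LetterLT) := (l.support.finite_toSet.image _).wellFoundedOn
  obtain ⟨w, hw, hmin⟩ : ∃ w ∈ l.support, ∀ v ∈ l.support, ¬ List.Lex LetterLT v.1 w.1 := by
    have hn : l.support.Nonempty := Finsupp.support_nonempty_iff.2 hne
    obtain ⟨v, hv⟩ := hn
    obtain ⟨⟨_, ⟨w, hw, rfl⟩⟩, -, hm⟩ :=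
      WellFounded.has_min wf Set.univ ⟨⟨v.1, v, hv, rfl⟩, trivial⟩
    exact ⟨w, hw, fun u hu => hm ⟨u.1, u, hu, rfl⟩ trivial⟩
  have hw' := (nonIncreasing_iff_isChain w.1).1 w.2
  let φ : QuadAlgebra d q →ₗ[K] ColoredPoly K I :=
    LinearMap.applyₗ (listMonomial K (leadingList w.1)) ∘ₗ
      (MulOpposite.opLinearEquiv K).symm.toLinearMap ∘ₗ (peelRep d hd q).toLinearMap
  have h := congrArg φ hl
  rw [Finsupp.linearCombination_apply, Finsupp.sum, map_sum, map_zero] at h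
  simp only [map_smul] at h
  rw [Finset.sum_eq_single_of_mem w hw] at h
  · exact smul_ne_zero (Finsupp.mem_support_iff.1 hw)
      (peelRep_leadingList_ne_zero d hd q hw') h
  · intro v hv hvw
    by_contra hz
    rcases wordLE_of_peelRep_leadingList_ne_zero d hd q hw' (right_ne_zero_of_smul hz) with h' | h'
    · exact hvw (Subtype.ext h')
    · exact hmin v hv h'

end Triangularity

/-! ### Monomials span the algebra -/

section

variable {K : Type*} [Field K] {I : Type*}

/-- The span contains 1 and is stable under left multiplication by the whole algebra. -/
theorem span_monomial_eq_top (d : Matrix I I ℤ) (q : K) :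
    Submodule.span K (Set.range (monomial d q)) = ⊤ := by
  rw [eq_top_iff]
  rintro a -
  obtain ⟨b, rfl⟩ := RingQuot.mkAlgHom_surjective K (QuadRel d q) a
  suffices H : ∀ x ∈ Submodule.span K (Set.range (monomial d q)),
      RingQuot.mkAlgHom K (QuadRel d q) b * x ∈ Submodule.span K (Set.range (monomial d q)) by
    have := H 1 (Submodule.subset_span ⟨[], by simp [monomial]⟩)
    rwa [mul_one] at this
  induction b using FreeAlgebra.induction with
  | grade0 r =>
    intro x hx
    rw [AlgHom.commutes, ← Algebra.smul_def]
    exact Submodule.smul_mem _ _ hx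
  | grade1 y =>
    intro x hx
    have hx' := Submodule.mem_map_of_mem
      (f := LinearMap.mulLeft K (RingQuot.mkAlgHom K (QuadRel d q) (FreeAlgebra.ι K y))) hx
    rw [Submodule.map_span] at hx'
    refine Submodule.span_mono ?_ hx'
    rintro _ ⟨_, ⟨w, rfl⟩, rfl⟩
    exact ⟨y :: w, monomial_cons d q y w⟩
  | mul a b ha hb =>
    intro x hx
    rw [map_mul, mul_assoc]
    exact ha _ (hb _ hx)
  | add a b ha hb =>
    intro x hx
    rw [map_add, add_mul]
    exact add_mem (ha _ hx) (hb _ hx)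

end

end QuantumLoop

theorem proposition4p2 :
    ∃ β : ℕ → ℕ,
      ∀ (K : Type*) [Field K] [CharZero K]
        (I : Type*) [Finite I] [LinearOrder I]
        (d : Matrix I I ℤ) (_ : QuantumLoop.IsSymmetricCartan d)
        (q : K) (_ : q ≠ 0) (_ : ∀ m : ℕ, 0 < m → q ^ m ≠ 1),
        (LinearIndependent K
            (fun w : {w : QuantumLoop.Word I // QuantumLoop.NonIncreasing w} =>
              QuantumLoop.monomial d q w.1) ∧
          Submodule.span K
            (Set.range fun w : {w : QuantumLoop.Word I // QuantumLoop.NonIncreasing w} =>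
              QuantumLoop.monomial d q w.1) = ⊤) ∧
        ∀ w : QuantumLoop.Word I,
          QuantumLoop.monomial d q w ∈
            Submodule.span K
              (QuantumLoop.monomial d q ''
                {v : QuantumLoop.Word I |
                  v.length = w.length ∧ QuantumLoop.NonIncreasing v ∧
                  QuantumLoop.WordLE w v ∧
                  QuantumLoop.ExponentsWithin (β w.length) w v}) := by
  refine ⟨fun _ => 0, fun K _ _ I _ _ d hd q _ _ => ⟨⟨?_, ?_⟩, ?_⟩⟩
  · exact QuantumLoop.linearIndependent_nonIncreasing d hd.symm q
  · rw [eq_top_iff, ← QuantumLoop.span_monomial_eq_top d q, Submodule.span_le]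
    rintro _ ⟨w, rfl⟩
    refine Submodule.span_mono ?_ (QuantumLoop.monomial_mem_span_nonIncreasing q w)
    rintro _ ⟨v, hv, rfl⟩
    exact ⟨⟨v, hv.2.1⟩, rfl⟩
  · exact fun w => QuantumLoop.monomial_mem_span_nonIncreasing q w
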